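/- Let $G=(V,E)$ be a finite simple undirected graph, let $K$ be the number of topics, and let $c\in[0,\infty)$ (confidence bound), $\mu\in(0,1/2]$ (compromise parameter) and $\omega\in[0,1]$ (topic weight). For opinion vectors $x,y\in\mathbb{R}^K$ and a topic $k\in\{1,\dots,K\}$ put $$d_k(x,y)=\omega\,|x^k-y^k|+\frac{1-\omega}{K}\sum_{\ell=1}^K|x^\ell-y^\ell|.$$ In the topic-weighted Deffuant--Weisbuch (DW) model, each node $i\in V$ has an opinion vector $x_i(t)\in\mathbb{R}^K$ at each time $t=0,1,2,\dots$, and the opinion state is $X(t)=(x_i(t))_{i\in V}\in\mathbb{R}^{|V|K}$, with arbitrary initial state $X(0)$. At each time $t$, an edge $(i,j)\in E$ and a topic $k\in\{1,\dots,K\}$ are selected uniformly at random, independently of each other and of the selections at other times. If $d_k(x_i(t),x_j(t))<c$, then $$x_i^k(t+1)=x_i^k(t)+\mu\,[x_j^k(t)-x_i^k(t)],\qquad x_j^k(t+1)=x_j^k(t)+\mu\,[x_i^k(t)-x_j^k(t)],$$ and all other entries of the opinion state remain unchanged; if $d_k(x_i(t),x_j(t))\ge c$, then $X(t+1)=X(t)$.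 Then, for every realization of the random edge and topic selections (not only almost surely), the limit $X^*=\lim_{t\to\infty}X(t)$ exists in $\mathbb{R}^{|V|K}$. -/

import Mathlib

open MeasureTheory ProbabilityTheory Filter Topology

namespace TopicWeightedDW

/-- Opinion states: `X i k` is the opinion of node `i` on topic `k`, so that `X i` is the opinion
vector of node `i`. The topology is the product topology, i.e. the usual one of `ℝ^(M K)`. -/
abbrev OpinionState (V : Type*) (K : ℕ) : Type _ := V → Fin K → ℝ

/-- The discordance function
`d_k(x, y) = ω |x^k - y^k| + ((1 - ω) / K) * ∑_ℓ |x^ℓ - y^ℓ|` with topic weight `ω`. -/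
noncomputable def discordance {K : ℕ} (ω : ℝ) (k : Fin K) (x y : Fin K → ℝ) : ℝ :=
  ω * |x k - y k| + (1 - ω) / (K : ℝ) * ∑ l : Fin K, |x l - y l|

/-- The new opinion state after nodes `i` and `j` interact on topic `k`, for confidence bound `c`,
compromise parameter `μ` and topic weight `ω`. If `d_k(x_i, x_j) < c`, both nodes move towards each
other on topic `k` (each using the other's old opinion); everything else stays unchanged. -/
noncomputable def interact {V : Type*} [DecidableEq V] {K : ℕ} (c μ ω : ℝ) (i j : V) (k : Fin K)
    (X : OpinionState V K) : OpinionState V K := fun v l =>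
  if l = k ∧ discordance ω k (X i) (X j) < c then
    if v = i then X i k + μ * (X j k - X i k)
    else if v = j then X j k + μ * (X i k - X j k)
    else X v l
  else X v l

/-- `edge t` and `topic t` are the randomly selected edge and topic at time `t`: each pair
`(edge t, topic t)` is uniformly distributed on `E × {1, …, K}` (so the edge and the topic are
uniform and independent of each other), and the pairs for different times are independent. -/
structure IsUniformSelection {V : Type*} (G : SimpleGraph V) (K : ℕ)
    {Ω : Type*} [MeasurableSpace Ω] (P : Measure Ω)
    (edge : ℕ → Ω → G.edgeSet) (topic : ℕ → Ω → Fin K) : Prop where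
  measurable_edge : ∀ t, Measurable[_, ⊤] (edge t)
  measurable_topic : ∀ t, Measurable[_, ⊤] (topic t)
  uniform : ∀ (t : ℕ) (e : G.edgeSet) (k : Fin K),
    P.real {s | edge t s = e ∧ topic t s = k} = 1 / ((Nat.card G.edgeSet : ℝ) * (K : ℝ))
  indep : iIndepFun (m := fun _ => (⊤ : MeasurableSpace (G.edgeSet × Fin K)))
    (fun t s => (edge t s, topic t s)) P

/-- `X` is the random opinion state of the topic-weighted Deffuant--Weisbuch model on the graph `G`
with `K` topics, confidence bound `c`, compromise parameter `μ` and topic weight `ω`: edges and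
topics are selected independently and uniformly at random, and at each time the two endpoints of
the selected edge interact on the selected topic. The initial state `X 0` is arbitrary. -/
structure IsDWProcess {V : Type*} [DecidableEq V] (G : SimpleGraph V) (K : ℕ) (c μ ω : ℝ)
    {Ω : Type*} [MeasurableSpace Ω] (P : Measure Ω)
    (edge : ℕ → Ω → G.edgeSet) (topic : ℕ → Ω → Fin K)
    (X : ℕ → Ω → OpinionState V K) : Prop where
  selection : IsUniformSelection G K P edge topic
  update : ∀ (t : ℕ) (s : Ω) (i j : V), (edge t s : Sym2 V) = s(i, j) →
    X (t + 1) s = interact c μ ω i j (topic t s) (X t s)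

end TopicWeightedDW

/-!
The selections need not be random for convergence. On each topic separately, the opinions form a
vector `x t : V → ℝ` that, at each time, either stays put or has two of its entries `u, v` replaced
by `u + μ (v - u)` and `v + μ (u - v)`; the confidence bound only decides when this happens. Such a
sequence always converges:

* for every convex `φ : ℝ → ℝ` the sum `∑ i, φ (x t i)` is nonincreasing in `t`
  (`PairStep.sum_convex_le`), so `∑ i, |x t i - p|` converges for every `p`, and the decrease of
  `∑ i, (x t i) ^ 2` forces the increments to tend to `0` (`tendsto_increment`);
* the tent function of height and half-width `δ` at `p` is a combination of three functions
  `|· - q|`, so its sum over the entries converges too. Hence if some entry comes close to `p` at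
  arbitrarily late times, then at all late times some entry is within `δ` of `p`
  (`eventually_exists_near`);
* an entry that diverges oscillates between two values `a < b`, and since its increments vanish it
  comes close to every point of `(a, b)` at arbitrarily late times. Taking more than `|V|` points
  of `(a, b)` at distance `2δ` from each other contradicts the previous item, by the pigeonhole
  principle (`exists_tendsto_of_pairStep`).
-/

namespace TopicWeightedDW

/-- One step of scalar pairwise averaging from `x` to `y`: either nothing changes, or two distinct
entries move towards each other by the fraction `μ` of their difference. -/
def PairStep {V : Type*} (μ : ℝ) (x y : V → ℝ) : Prop :=
  y = x ∨ ∃ i j, i ≠ j ∧ y i = x i + μ * (x j - x i) ∧ y j = x j + μ * (x i - x j) ∧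
    ∀ v, v ≠ i → v ≠ j → y v = x v

theorem sum_sub_sum_eq_of_eq_off_pair {V : Type*} [Fintype V] {x y : V → ℝ} {i j : V}
    (hij : i ≠ j) (h : ∀ v, v ≠ i → v ≠ j → y v = x v) (φ : ℝ → ℝ) :
    ∑ v, φ (y v) - ∑ v, φ (x v) = φ (y i) - φ (x i) + (φ (y j) - φ (x j)) := by
  rw [← Finset.sum_sub_distrib]
  refine Fintype.sum_eq_add i j hij fun v hv => ?_
  rw [h v hv.1 hv.2, sub_self]

theorem PairStep.sum_convex_le {V : Type*} [Fintype V] {μ : ℝ} (hμ₀ : 0 ≤ μ) (hμ₁ : μ ≤ 1)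
    {x y : V → ℝ} (h : PairStep μ x y) {φ : ℝ → ℝ} (hφ : ConvexOn ℝ Set.univ φ) :
    ∑ v, φ (y v) ≤ ∑ v, φ (x v) := by
  rcases h with rfl | ⟨i, j, hij, hi, hj, hv⟩
  · exact le_rfl
  have key : ∀ u v : ℝ, φ (u + μ * (v - u)) ≤ (1 - μ) * φ u + μ * φ v := fun u v => by
    have := hφ.2 (Set.mem_univ u) (Set.mem_univ v) (sub_nonneg.2 hμ₁) hμ₀ (by ring)
    simp only [smul_eq_mul] at this
    rwa [show (1 - μ) * u + μ * v = u + μ * (v - u) by ring] at this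
  have hs := sum_sub_sum_eq_of_eq_off_pair hij hv φ
  have h1 := key (x i) (x j)
  have h2 := key (x j) (x i)
  rw [← hi] at h1
  rw [← hj] at h2
  linarith

/-- The squared increment of an entry is controlled by the decrease of the sum of squares: the
increment is `μ * d`, where `d` is the difference of the two entries, and the sum of squares drops
by `2 * μ * (1 - μ) * d ^ 2`, which is at least `μ ^ 2 * d ^ 2` as `μ ≤ 1 / 2`. -/
theorem PairStep.increment_sq_le {V : Type*} [Fintype V] {μ : ℝ} (hμ₀ : 0 ≤ μ) (hμ₁ : μ ≤ 1 / 2)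
    {x y : V → ℝ} (h : PairStep μ x y) (i : V) :
    (y i - x i) ^ 2 ≤ ∑ v, x v ^ 2 - ∑ v, y v ^ 2 := by
  rcases h with rfl | ⟨j, k, hjk, hj, hk, hv⟩
  · simp
  have hs := sum_sub_sum_eq_of_eq_off_pair hjk hv (fun r => r ^ 2)
  simp only [hj, hk] at hs
  have hdrop : μ ^ 2 * (x k - x j) ^ 2 ≤ ∑ v, x v ^ 2 - ∑ v, y v ^ 2 := by
    have : 0 ≤ μ * (2 - 3 * μ) * (x k - x j) ^ 2 :=
      mul_nonneg (mul_nonneg hμ₀ (by linarith)) (sq_nonneg _)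
    linarith
  by_cases h1 : i = j
  · subst h1
    rw [hj]
    linarith
  by_cases h2 : i = k
  · subst h2
    rw [hk]
    linarith
  rw [hv i h1 h2, sub_self, zero_pow two_ne_zero]
  exact le_trans (by positivity) hdrop

theorem exists_tendsto_sum_convex {V : Type*} [Fintype V] {μ : ℝ} (hμ₀ : 0 ≤ μ) (hμ₁ : μ ≤ 1)
    {x : ℕ → V → ℝ} (hx : ∀ t, PairStep μ (x t) (x (t + 1))) {φ : ℝ → ℝ}
    (hφ : ConvexOn ℝ Set.univ φ) (hpos : ∀ r, 0 ≤ φ r) :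
    ∃ L, Tendsto (fun t => ∑ v, φ (x t v)) atTop (𝓝 L) :=
  ⟨_, tendsto_atTop_ciInf (antitone_nat_of_succ_le fun t => (hx t).sum_convex_le hμ₀ hμ₁ hφ)
    ⟨0, by rintro _ ⟨t, rfl⟩; exact Finset.sum_nonneg fun v _ => hpos _⟩⟩

theorem convexOn_abs_sub (p : ℝ) : ConvexOn ℝ Set.univ fun r : ℝ => |r - p| := by
  simpa [Real.dist_eq] using convexOn_univ_dist p

theorem tendsto_increment {V : Type*} [Fintype V] {μ : ℝ} (hμ₀ : 0 ≤ μ) (hμ₁ : μ ≤ 1 / 2)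
    {x : ℕ → V → ℝ} (hx : ∀ t, PairStep μ (x t) (x (t + 1))) (i : V) :
    Tendsto (fun t => x (t + 1) i - x t i) atTop (𝓝 0) := by
  obtain ⟨L, hL⟩ := exists_tendsto_sum_convex hμ₀ (by linarith) hx (even_two.convexOn_pow)
    fun r => sq_nonneg r
  have h0 : Tendsto (fun t => ∑ v, x t v ^ 2 - ∑ v, x (t + 1) v ^ 2) atTop (𝓝 0) := by
    simpa using hL.sub (hL.comp (tendsto_add_atTop_nat 1))
  have hsq : Tendsto (fun t => (x (t + 1) i - x t i) ^ 2) atTop (𝓝 0) :=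
    squeeze_zero (fun t => sq_nonneg _) (fun t => (hx t).increment_sq_le hμ₀ hμ₁ i) h0
  rw [tendsto_zero_iff_abs_tendsto_zero]
  simpa [Function.comp_def, Real.sqrt_sq_eq_abs] using hsq.sqrt

/-- The tent function `max 0 (δ - |r - p|)` as a combination of translates of the absolute value. -/
theorem tent_eq {δ : ℝ} (hδ : 0 ≤ δ) (p r : ℝ) :
    max 0 (δ - |r - p|) = (|r - (p - δ)| + |r - (p + δ)|) / 2 - |r - p| := by
  grind

/-- If some entry is within `δ / 2` of `p` at arbitrarily late times, then at all late times
some entry, possibly a different one, is within `δ` of `p`. -/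
theorem eventually_exists_near {V : Type*} [Fintype V] {μ : ℝ} (hμ₀ : 0 ≤ μ) (hμ₁ : μ ≤ 1)
    {x : ℕ → V → ℝ} (hx : ∀ t, PairStep μ (x t) (x (t + 1))) {i : V} {p δ : ℝ} (hδ : 0 < δ)
    (hp : ∃ᶠ t in atTop, |x t i - p| ≤ δ / 2) :
    ∀ᶠ t in atTop, ∃ j, |x t j - p| < δ := by
  have habs := fun q => exists_tendsto_sum_convex hμ₀ hμ₁ hx (convexOn_abs_sub q)
    fun r => abs_nonneg _
  obtain ⟨L₁, h₁⟩ := habs (p - δ)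
  obtain ⟨L₂, h₂⟩ := habs (p + δ)
  obtain ⟨L₃, h₃⟩ := habs p
  have hT : Tendsto (fun t => ∑ v, max 0 (δ - |x t v - p|)) atTop
      (𝓝 ((L₁ + L₂) / 2 - L₃)) := by
    refine (((h₁.add h₂).div_const 2).sub h₃).congr fun t => ?_
    simp only [tent_eq hδ.le, Finset.sum_sub_distrib, ← Finset.sum_div, Finset.sum_add_distrib]
  have hfreq : ∃ᶠ t in atTop, δ / 2 ≤ ∑ v, max 0 (δ - |x t v - p|) := by
    refine hp.mono fun t ht => ?_
    calc δ / 2 ≤ max 0 (δ - |x t i - p|) := le_max_of_le_right (by linarith)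
      _ ≤ _ := Finset.single_le_sum (f := fun v => max 0 (δ - |x t v - p|))
        (fun v _ => le_max_left _ _) (Finset.mem_univ i)
  have hL : δ / 2 ≤ (L₁ + L₂) / 2 - L₃ := ge_of_tendsto_of_frequently hT hfreq
  filter_upwards [hT.eventually (lt_mem_nhds (show 0 < (L₁ + L₂) / 2 - L₃ by linarith))] with t ht
  by_contra! hfar
  refine ht.ne' (Finset.sum_eq_zero fun v _ => max_eq_left ?_)
  linarith [hfar v]

/-- A real sequence with vanishing increments that is below `p` and above `p` at arbitrarily late
times is close to `p` at arbitrarily late times. -/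
theorem frequently_abs_sub_le_of_crossing {u : ℕ → ℝ}
    (hu : Tendsto (fun t => u (t + 1) - u t) atTop (𝓝 0)) {p ε : ℝ} (hε : 0 < ε)
    (hlt : ∃ᶠ t in atTop, u t < p) (hgt : ∃ᶠ t in atTop, p < u t) :
    ∃ᶠ t in atTop, |u t - p| ≤ ε := by
  rw [frequently_atTop]
  intro N
  obtain ⟨M, hM⟩ := eventually_atTop.1 (hu.eventually (Metric.ball_mem_nhds 0 hε))
  obtain ⟨m, hm, hum⟩ := frequently_atTop.1 hlt (max N M)
  obtain ⟨n, hn, hun⟩ := frequently_atTop.1 hgt m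
  by_contra! hfar
  -- Without a visit near `p`, the sequence cannot jump from below `p` to above it after time `m`.
  have hbelow : ∀ t, m ≤ t → u t < p := by
    intro t ht
    induction t, ht using Nat.le_induction with
    | base => exact hum
    | succ t ht ih =>
      have h1 := hM t (by omega)
      have h2 := hfar t (by omega)
      rw [Real.dist_eq, sub_zero, abs_lt] at h1
      rw [abs_of_neg (by linarith)] at h2
      linarith
  exact lt_asymm hun (hbelow n hn)

theorem exists_tendsto_of_pairStep {V : Type*} [Fintype V] {μ : ℝ} (hμ₀ : 0 ≤ μ)
    (hμ₁ : μ ≤ 1 / 2) {x : ℕ → V → ℝ} (hx : ∀ t, PairStep μ (x t) (x (t + 1))) (i : V) :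
    ∃ L, Tendsto (fun t => x t i) atTop (𝓝 L) := by
  have hbdd : ∀ t, |x t i| ≤ ∑ v, |x 0 v| := by
    intro t
    have hanti : Antitone fun t => ∑ v, |x t v| := antitone_nat_of_succ_le fun t => by
      simpa using (hx t).sum_convex_le hμ₀ (by linarith) (convexOn_abs_sub 0)
    exact (Finset.single_le_sum (f := fun v => |x t v|) (fun v _ => abs_nonneg _)
      (Finset.mem_univ i)).trans (hanti (Nat.zero_le t))
  refine tendsto_of_no_upcrossings dense_univ ?_
    (isBoundedUnder_of ⟨_, fun t => (abs_le.1 (hbdd t)).2⟩)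
    (isBoundedUnder_of ⟨_, fun t => (abs_le.1 (hbdd t)).1⟩)
  rintro a - b - hab ⟨ha, hb⟩
  -- The points `a + (2 m + 1) δ` for `m ≤ |V|` lie in `(a, b)`, at distance at least `2δ`.
  obtain ⟨δ, hδ, hδb⟩ : ∃ δ : ℝ, 0 < δ ∧ b = a + 2 * (Fintype.card V + 1) * δ :=
    ⟨(b - a) / (2 * (Fintype.card V + 1)), div_pos (sub_pos.2 hab) (by positivity), by
      field_simp; ring⟩
  have hnear : ∀ m : Fin (Fintype.card V + 1),
      ∀ᶠ t in atTop, ∃ j, |x t j - (a + (2 * (m : ℝ) + 1) * δ)| < δ := by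
    intro m
    have hm : (m : ℝ) + 1 ≤ Fintype.card V + 1 := by exact_mod_cast m.2
    have hpa : a < a + (2 * (m : ℝ) + 1) * δ := by
      have : 0 < (2 * (m : ℝ) + 1) * δ := by positivity
      linarith
    have hpb : a + (2 * (m : ℝ) + 1) * δ < b := by
      have : (2 * (m : ℝ) + 1) * δ < 2 * (Fintype.card V + 1) * δ :=
        mul_lt_mul_of_pos_right (by linarith) hδ
      linarith
    exact eventually_exists_near hμ₀ (by linarith) hx hδ
      (frequently_abs_sub_le_of_crossing (tendsto_increment hμ₀ hμ₁ hx i) (half_pos hδ)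
        (ha.mono fun t ht => ht.trans hpa) (hb.mono fun t ht => hpb.trans ht))
  obtain ⟨t, ht⟩ := (eventually_all.2 hnear).exists
  choose f hf using ht
  obtain ⟨m, n, hmn, hfmn⟩ := Fintype.exists_ne_map_eq_of_card_lt f (by simp)
  wlog hlt : m < n generalizing m n
  · exact this n m hmn.symm hfmn.symm (lt_of_le_of_ne (not_lt.1 hlt) hmn.symm)
  have hm := abs_lt.1 (hf m)
  have hn := abs_lt.1 (hf n)
  rw [hfmn] at hm
  have hle : ((m : ℝ) + 1) * δ ≤ n * δ :=
    mul_le_mul_of_nonneg_right (by exact_mod_cast hlt) hδ.le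
  linarith [hm.2, hn.1]

/-- On each topic, an interaction of two distinct nodes is a step of pairwise averaging. -/
theorem pairStep_interact {V : Type*} [DecidableEq V] {K : ℕ} (c μ ω : ℝ) {i j : V} (hij : i ≠ j)
    (k l : Fin K) (X : OpinionState V K) :
    PairStep μ (fun v => X v l) (fun v => interact c μ ω i j k X v l) := by
  by_cases h : l = k ∧ discordance ω k (X i) (X j) < c
  · obtain ⟨rfl, h⟩ := h
    refine Or.inr ⟨i, j, hij, ?_, ?_, fun v hi hj => ?_⟩
    · simp [interact, h]
    · simp [interact, h, hij.symm]
    · simp [interact, hi, hj]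
  · exact Or.inl (funext fun v => if_neg h)

end TopicWeightedDW

open TopicWeightedDW in
theorem theorem3p3 {V : Type*} [Fintype V] [DecidableEq V] (G : SimpleGraph V) (K : ℕ)
    (c μ ω : ℝ) (hc : 0 ≤ c) (hμ₀ : 0 < μ) (hμ₁ : μ ≤ 1 / 2) (hω₀ : 0 ≤ ω) (hω₁ : ω ≤ 1)
    {Ω : Type*} [MeasurableSpace Ω] (P : Measure Ω) [IsProbabilityMeasure P]
    (edge : ℕ → Ω → G.edgeSet) (topic : ℕ → Ω → Fin K)
    (X : ℕ → Ω → TopicWeightedDW.OpinionState V K)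
    (hX : TopicWeightedDW.IsDWProcess G K c μ ω P edge topic X) :
    ∀ s : Ω, ∃ Xlim : TopicWeightedDW.OpinionState V K,
      Tendsto (fun t : ℕ => X t s) atTop (𝓝 Xlim) := by
  intro s
  have hstep : ∀ (k : Fin K) (t : ℕ),
      PairStep μ (fun v => X t s v k) (fun v => X (t + 1) s v k) := by
    intro k t
    obtain ⟨e, he⟩ : ∃ e, e = edge t s := ⟨_, rfl⟩
    obtain ⟨⟨i, j⟩, hadj⟩ := e
    rw [hX.update t s i j (by rw [← he])]
    exact pairStep_interact c μ ω (G.ne_of_adj hadj) _ k (X t s)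
  choose L hL using fun (v : V) (k : Fin K) =>
    exists_tendsto_of_pairStep hμ₀.le hμ₁ (hstep k) v
  exact ⟨L, tendsto_pi_nhds.2 fun v => tendsto_pi_nhds.2 fun k => hL v k⟩
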